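/- Let $Q_8$ be the quaternion group of order $8$, acting faithfully by automorphisms on $\mathbb{Z}_3^2$, and let $G\cong\mathbb{Z}_3^2\rtimes Q_8$ be the corresponding semidirect product (the Frobenius group of order $72$ with complement $Q_8$). Let $C_0=\{e\},C_1,\dots,C_d$ be the conjugacy classes of $G$, let $A_i$ be the $G\times G$ matrix over $\mathbb{C}$ with $(x,y)$ entry $1$ if $yx^{-1}\in C_i$ and $0$ otherwise, and let $E_i^*$ be the diagonal matrix with $(y,y)$ entry $(A_i)_{e,y}$. Let $\mathfrak{A}=\operatorname{Span}_{\mathbb{C}}\{A_i : 0\le i\le d\}$ and $\mathfrak{A}^*=\operatorname{Span}_{\mathbb{C}}\{E_i^* : 0\le i\le d\}$, and let $T(G)\subseteq M_{|G|}(\mathbb{C})$ be the subalgebra generated by $\mathfrak{A}$ and $\mathfrak{A}^*$ (the Terwilliger algebra of the group association scheme of $G$ with base point $e$). Let $\hat e\in\mathbb{C}^{|G|}$ be the standard basis vector at $e$. The primary component of $T(G)$ is the minimal nonzero two-sided ideal $V$ of $T(G)$ that acts nontrivially on the primary module $\mathfrak{A}\hat e$. Then the Wedderburn decomposition of $T(G)$,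 that is, its decomposition as a direct sum of minimal nonzero two-sided ideals, is $$T(G)=V\oplus Z_1\oplus Z_2\oplus\cdots\oplus Z_8,$$ where $V$ is the primary component, of dimension $(d+1)^2$, and each $Z_i$, $1\le i\le 8$, is a one-dimensional two-sided ideal of $T(G)$. Moreover, $\dim_{\mathbb{C}} T(G)=44$. -/

import Mathlib

/-! The group association scheme of a finite group `G` (relations indexed by the conjugacy classes
of `G`) and its Terwilliger algebra with base point the identity. -/

namespace GroupScheme

open scoped Classical in
/-- The adjacency matrix `A_C` of the conjugacy class `C`: its `(x, y)` entry is `1` if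
`y * x⁻¹ ∈ C` and `0` otherwise. -/
noncomputable def adjMatrix {G : Type*} [Group G] (C : ConjClasses G) : Matrix G G ℂ :=
  Matrix.of fun x y => if y * x⁻¹ ∈ C.carrier then 1 else 0

/-- The dual idempotent `E*_C` with base point `1`: the diagonal matrix whose `(y, y)` entry is `1`
if `(1, y)` lies in the relation of `C`, and `0` otherwise. -/
noncomputable def dualIdempotent {G : Type*} [Group G] [DecidableEq G] (C : ConjClasses G) :
    Matrix G G ℂ :=
  Matrix.diagonal fun y => adjMatrix C 1 y

/-- The Bose-Mesner algebra, as the span of the adjacency matrices. -/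
def boseMesner (G : Type*) [Group G] : Submodule ℂ (Matrix G G ℂ) :=
  Submodule.span ℂ (Set.range (adjMatrix (G := G)))

/-- The dual Bose-Mesner algebra with respect to the base point `1`. -/
def dualBoseMesner (G : Type*) [Group G] [DecidableEq G] :
    Submodule ℂ (Matrix G G ℂ) :=
  Submodule.span ℂ (Set.range (dualIdempotent (G := G)))

/-- The Terwilliger algebra `T(G)`: the subalgebra of the full matrix algebra generated by the
Bose-Mesner algebra and the dual Bose-Mesner algebra. -/
def terwilliger (G : Type*) [Group G] [Fintype G] [DecidableEq G] :
    Subalgebra ℂ (Matrix G G ℂ) :=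
  Algebra.adjoin ℂ ((boseMesner G : Set (Matrix G G ℂ)) ∪ (dualBoseMesner G : Set (Matrix G G ℂ)))

/-- The primary module: all vectors `A *ᵥ e₁` with `A` in the Bose-Mesner algebra, where `e₁` is
the standard basis vector at the identity of `G`. -/
def primaryModule (G : Type*) [Group G] [Fintype G] [DecidableEq G] : Submodule ℂ (G → ℂ) :=
  (boseMesner G).map ((Matrix.mulVecBilin ℂ ℂ).flip (Pi.single (1 : G) (1 : ℂ)))

/-- `I` is a minimal nonzero two-sided ideal. -/
def IsMinimalTwoSided {R : Type*} [Ring R] (I : Ideal R) : Prop :=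
  Minimal (fun J : Ideal R => J.IsTwoSided ∧ J ≠ ⊥) I

/-- The family `I` is the Wedderburn decomposition of `R`: every `I i` is a minimal nonzero
two-sided ideal, and `R` is the (internal) direct sum of the `I i`. -/
def IsWedderburnDecomposition {R ι : Type*} [Ring R] [DecidableEq ι] (I : ι → Ideal R) : Prop :=
  (∀ i, IsMinimalTwoSided (I i)) ∧ DirectSum.IsInternal I

/-- `V` is the primary component of `T(G)`: the minimal nonzero two-sided ideal that acts
nontrivially on the primary module. -/
def IsPrimaryComponent {G : Type*} [Group G] [Fintype G] [DecidableEq G]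
    (V : Ideal (terwilliger G)) : Prop :=
  IsMinimalTwoSided V ∧
    ∃ t ∈ V, ∃ v ∈ primaryModule G, Matrix.mulVec (t : Matrix G G ℂ) v ≠ 0

end GroupScheme

/-! Let `π : G → Q₈` be the projection, with kernel `N ≅ ℤ₃²`. The action on `N` has no nontrivial
fixed points, so the classes of `G` are `{1}`, `N \ {1}` and the preimages of the four nontrivial
classes of `Q₈`. This gives six colours (`isConj_iff_gpColor`).

The crux is `gpColor_mul_inv`. If `x` and `y` have different colours, the class of `y * x⁻¹` depends
on those colours alone. If they have the same colour, it only records whether `x = y`, whether `π x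
= π y` with `x ≠ y`, or neither. Hence each adjacency matrix is block-constant plus a combination of
the identity and of the relation "same colour and same coset of `N`".

So `T(G)` is spanned by the block-constant matrices, a copy of `M₆(ℂ)` whose unit is the averaging
over colours, and by idempotents that split each colour class first into cosets and then into points
(`toSubmodule_terwilliger`). These idempotents are central and orthogonal to the blocks, and `T(G)`
acts on each by scalars. The splitting into points is nonzero on the five nontrivial colours, the
splitting into cosets on the three classes `{±i}`, `{±j}`, `{±k}`. That makes eight, and `36 + 8 =
44`. The Wedderburn decomposition of any algebra of this shape is
`IsRefining.isWedderburnDecomposition`. -/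

namespace GroupScheme

/-! ### Averaging over the fibres of a map, and the idempotents of a refinement. -/

section Fibers

set_option linter.unusedSectionVars false

variable {X Y ι : Type*} [Fintype X] [DecidableEq X] [DecidableEq Y] [DecidableEq ι]

/-- The matrix of the operator averaging a function on `X` over the fibers of `p`. -/
noncomputable def avg (p : X → Y) : Matrix X X ℂ :=
  Matrix.of fun x y => if p x = p y then ((Finset.univ.filter fun z => p z = p x).card : ℂ)⁻¹ else 0

/-- The diagonal indicator matrix of the fiber of `κ` over `c`. -/
def fiberDiag (κ : X → ι) (c : ι) : Matrix X X ℂ :=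
  Matrix.diagonal fun x => if κ x = c then 1 else 0

/-- The inflation of a matrix along `κ`, constant on the blocks given by the fibers of `κ`. -/
def inflate (κ : X → ι) : Matrix ι ι ℂ →ₗ[ℂ] Matrix X X ℂ where
  toFun f := f.submatrix κ κ
  map_add' _ _ := rfl
  map_smul' _ _ := rfl

theorem inflate_apply (κ : X → ι) (f : Matrix ι ι ℂ) (x y : X) :
    inflate κ f x y = f (κ x) (κ y) := rfl

theorem fiber_card_ne_zero (p : X → Y) (x : X) :
    ((Finset.univ.filter fun z => p z = p x).card : ℂ) ≠ 0 := by
  rw [Nat.cast_ne_zero, Finset.card_ne_zero]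
  exact ⟨x, by simp⟩

theorem avg_mul_of_rows (p : X → Y) {M : Matrix X X ℂ}
    (h : ∀ x x' y, p x = p x' → M x y = M x' y) : avg p * M = M := by
  ext x y
  have : ∀ z, avg p x z * M z y =
      if p z = p x then ((Finset.univ.filter fun z => p z = p x).card : ℂ)⁻¹ * M x y else 0 := by
    intro z
    by_cases hz : p z = p x
    · simp [avg, hz, h z x y hz]
    · simp [avg, hz, Ne.symm hz]
  rw [Matrix.mul_apply, Finset.sum_congr rfl fun z _ => this z, ← Finset.sum_filter,
    Finset.sum_const, nsmul_eq_mul, ← mul_assoc, mul_inv_cancel₀ (fiber_card_ne_zero p x), one_mul]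

theorem avg_transpose (p : X → Y) : (avg p).transpose = avg p := by
  ext x y
  by_cases h : p x = p y
  · simp [avg, h]
  · simp [avg, h, Ne.symm h]

theorem mul_avg_of_cols (p : X → Y) {M : Matrix X X ℂ}
    (h : ∀ x y y', p y = p y' → M x y = M x y') : M * avg p = M := by
  rw [← Matrix.transpose_inj, Matrix.transpose_mul, avg_transpose]
  exact avg_mul_of_rows p fun x x' y hx => h y x x' hx

theorem avg_congr_left (p : X → Y) {x x' : X} (y : X) (h : p x = p x') : avg p x y = avg p x' y := by
  simp [avg, h]

theorem avg_congr_right (p : X → Y) (x : X) {y y' : X} (h : p y = p y') :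
    avg p x y = avg p x y' := by
  simp [avg, h]

theorem avg_mul_self (p : X → Y) : avg p * avg p = avg p :=
  avg_mul_of_rows p fun _ _ y h => avg_congr_left p y h

theorem avg_mul_avg {κ : X → ι} {ρ : X → Y} (h : ∀ x y, ρ x = ρ y → κ x = κ y) :
    avg ρ * avg κ = avg κ :=
  avg_mul_of_rows ρ fun x x' y hx => avg_congr_left κ y (h x x' hx)

theorem avg_mul_avg' {κ : X → ι} {ρ : X → Y} (h : ∀ x y, ρ x = ρ y → κ x = κ y) :
    avg κ * avg ρ = avg κ :=
  mul_avg_of_cols ρ fun x y y' hy => avg_congr_right κ x (h y y' hy)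

theorem avg_mul_inflate (κ : X → ι) (f : Matrix ι ι ℂ) : avg κ * inflate κ f = inflate κ f :=
  avg_mul_of_rows κ fun x x' y hx => by simp [inflate_apply, hx]

theorem inflate_mul_avg (κ : X → ι) (f : Matrix ι ι ℂ) : inflate κ f * avg κ = inflate κ f :=
  mul_avg_of_cols κ fun x x' y hx => by simp [inflate_apply, hx]

theorem exists_inflate {κ : X → ι} {M : Matrix X X ℂ}
    (h : ∀ x x' y y', κ x = κ x' → κ y = κ y' → M x y = M x' y')
    (hκ : Function.Surjective κ) : ∃ f, inflate κ f = M := by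
  refine ⟨Matrix.of fun a b => M (Function.surjInv hκ a) (Function.surjInv hκ b), ?_⟩
  ext x y
  exact h _ _ _ _ (Function.surjInv_eq hκ _) (Function.surjInv_eq hκ _)

theorem exists_inflate_eq_avg {κ : X → ι} (hκ : Function.Surjective κ) :
    ∃ f, inflate κ f = avg κ :=
  exists_inflate (fun _ x' y _ hx hy =>
    (avg_congr_left κ y hx).trans (avg_congr_right κ x' hy)) hκ

theorem mul_inflate_eq_zero {κ : X → ι} {M : Matrix X X ℂ} (h : M * avg κ = 0)
    (f : Matrix ι ι ℂ) : M * inflate κ f = 0 := by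
  rw [← avg_mul_inflate, ← mul_assoc, h, zero_mul]

theorem inflate_mul_eq_zero {κ : X → ι} {M : Matrix X X ℂ} (h : avg κ * M = 0)
    (f : Matrix ι ι ℂ) : inflate κ f * M = 0 := by
  rw [← inflate_mul_avg, mul_assoc, h, mul_zero]

theorem fiberDiag_mul_apply (κ : X → ι) (c : ι) (M : Matrix X X ℂ) (x y : X) :
    (fiberDiag κ c * M) x y = if κ x = c then M x y else 0 := by
  simp [fiberDiag, Matrix.diagonal_mul]

theorem mul_fiberDiag_apply (κ : X → ι) (c : ι) (M : Matrix X X ℂ) (x y : X) :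
    (M * fiberDiag κ c) x y = if κ y = c then M x y else 0 := by
  simp [fiberDiag, Matrix.mul_diagonal]

theorem fiberDiag_mul_self (κ : X → ι) (c : ι) :
    fiberDiag κ c * fiberDiag κ c = fiberDiag κ c := by
  ext x y
  rw [fiberDiag_mul_apply]
  by_cases h : κ x = c <;> by_cases hxy : x = y <;> simp [fiberDiag, h, hxy]

theorem fiberDiag_mul_of_ne (κ : X → ι) {c d : ι} (h : c ≠ d) :
    fiberDiag κ c * fiberDiag κ d = 0 := by
  ext x y
  rw [fiberDiag_mul_apply]
  by_cases hc : κ x = c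
  · have : κ x ≠ d := fun hd => h (hc.symm.trans hd)
    by_cases hxy : x = y <;> simp [fiberDiag, Matrix.diagonal_apply, this]
  · simp [hc]

theorem sum_fiberDiag [Fintype ι] (κ : X → ι) : ∑ c, fiberDiag κ c = 1 := by
  ext x y
  by_cases hxy : x = y
  · subst hxy; simp [fiberDiag, Matrix.sum_apply]
  · simp [fiberDiag, Matrix.sum_apply, hxy]

theorem fiberDiag_commute_avg {κ : X → ι} {ρ : X → Y} (h : ∀ x y, ρ x = ρ y → κ x = κ y) (c : ι) :
    Commute (fiberDiag κ c) (avg ρ) := by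
  ext x y
  rw [fiberDiag_mul_apply, mul_fiberDiag_apply]
  by_cases hxy : ρ x = ρ y
  · rw [h x y hxy]
  · simp [avg, hxy]

theorem fiberDiag_mul_inflate (κ : X → ι) (c : ι) (f : Matrix ι ι ℂ) :
    fiberDiag κ c * inflate κ f = inflate κ (Matrix.of fun a b => if a = c then f a b else 0) := by
  ext x y
  rw [fiberDiag_mul_apply]; rfl

/-- The sum over `z` is grouped by the colour of `z`, so each colour contributes its fibre size.
Inflation is therefore multiplicative only for the product twisted by the diagonal matrix of fibre
sizes. -/
theorem inflate_mul_inflate [Fintype ι] (κ : X → ι) (f g : Matrix ι ι ℂ) :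
    inflate κ f * inflate κ g = inflate κ (f *
      Matrix.diagonal (fun c => ((Finset.univ.filter fun z => κ z = c).card : ℂ)) * g) := by
  ext x y
  rw [Matrix.mul_apply, inflate_apply, Matrix.mul_apply]
  simp only [inflate_apply, Matrix.mul_diagonal]
  rw [← Finset.sum_fiberwise_of_maps_to (g := κ) (t := Finset.univ) (fun _ _ => Finset.mem_univ _)]
  refine Finset.sum_congr rfl fun c _ => ?_
  rw [Finset.sum_congr rfl (g := fun _ => f (κ x) c * g c (κ y)), Finset.sum_const, nsmul_eq_mul]
  · ring
  · intro z hz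
    rw [(Finset.mem_filter.1 hz).2]

variable (κ : X → ι) (ρ : X → Y)

/-- The two idempotents refining the averaging over the fibers of `κ`, where `ρ` is finer
than `κ`. -/
noncomputable def refinement : Bool → Matrix X X ℂ
  | false => 1 - avg ρ
  | true => avg ρ - avg κ

/-- The part of a refining idempotent that lives on a fiber of `κ`. -/
noncomputable def fiberIdem (p : ι × Bool) : Matrix X X ℂ :=
  fiberDiag κ p.1 * refinement κ ρ p.2

variable {κ ρ} (h : ∀ x y, ρ x = ρ y → κ x = κ y)
include h

theorem refinement_mul_self (s : Bool) :
    refinement κ ρ s * refinement κ ρ s = refinement κ ρ s := by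
  cases s <;> simp only [refinement, mul_sub, sub_mul, avg_mul_self, mul_one, one_mul, avg_mul_avg h,
    avg_mul_avg' h] <;> abel

theorem refinement_mul_of_ne {s t : Bool} (hst : s ≠ t) :
    refinement κ ρ s * refinement κ ρ t = 0 := by
  cases s <;> cases t <;> first | exact absurd rfl hst | skip
  all_goals
    simp only [refinement, mul_sub, sub_mul, avg_mul_self, mul_one, one_mul, avg_mul_avg h,
      avg_mul_avg' h]
    abel

theorem refinement_mul_avg (s : Bool) : refinement κ ρ s * avg κ = 0 := by
  cases s <;> simp [refinement, sub_mul, avg_mul_self, avg_mul_avg h]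

theorem avg_mul_refinement (s : Bool) : avg κ * refinement κ ρ s = 0 := by
  cases s <;> simp [refinement, mul_sub, avg_mul_self, avg_mul_avg' h]

theorem fiberDiag_commute_refinement (c : ι) (s : Bool) :
    Commute (fiberDiag κ c) (refinement κ ρ s) := by
  cases s
  · exact (Commute.one_right _).sub_right (fiberDiag_commute_avg h c)
  · exact (fiberDiag_commute_avg h c).sub_right (fiberDiag_commute_avg (fun _ _ => id) c)

theorem fiberIdem_mul (p q : ι × Bool) : fiberIdem κ ρ p * fiberIdem κ ρ q =
    (fiberDiag κ p.1 * fiberDiag κ q.1) * (refinement κ ρ p.2 * refinement κ ρ q.2) := by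
  rw [fiberIdem, fiberIdem, mul_assoc, mul_assoc, ← mul_assoc (refinement κ ρ p.2),
    ← (fiberDiag_commute_refinement h q.1 p.2).eq, mul_assoc]

theorem fiberIdem_mul_self (p : ι × Bool) :
    fiberIdem κ ρ p * fiberIdem κ ρ p = fiberIdem κ ρ p := by
  rw [fiberIdem_mul h, fiberDiag_mul_self, refinement_mul_self h, fiberIdem]

theorem fiberIdem_mul_of_ne {p q : ι × Bool} (hpq : p ≠ q) :
    fiberIdem κ ρ p * fiberIdem κ ρ q = 0 := by
  rw [fiberIdem_mul h]
  by_cases h1 : p.1 = q.1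
  · rw [refinement_mul_of_ne h fun h2 => hpq (Prod.ext h1 h2), mul_zero]
  · rw [fiberDiag_mul_of_ne κ h1, zero_mul]

theorem fiberIdem_mul_avg (p : ι × Bool) : fiberIdem κ ρ p * avg κ = 0 := by
  rw [fiberIdem, mul_assoc, refinement_mul_avg h, mul_zero]

theorem avg_mul_fiberIdem (p : ι × Bool) : avg κ * fiberIdem κ ρ p = 0 := by
  rw [fiberIdem, (fiberDiag_commute_refinement h _ _).eq, ← mul_assoc, avg_mul_refinement h,
    zero_mul]

omit h

/-- The sum telescopes: `avg κ + (avg ρ - avg κ) + (1 - avg ρ) = 1`. -/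
theorem avg_add_sum_fiberIdem [Fintype ι] : avg κ + ∑ p, fiberIdem κ ρ p = 1 := by
  simp only [fiberIdem, Fintype.sum_prod_type, Fintype.sum_bool, ← mul_add, ← Finset.sum_mul,
    sum_fiberDiag, refinement]
  simp

theorem fiberIdem_apply_false (c : ι) (x y : X) : fiberIdem κ ρ (c, false) x y =
    if κ x = c then (1 - avg ρ) x y else 0 := by
  rw [fiberIdem, fiberDiag_mul_apply]; rfl

theorem fiberIdem_apply_true (c : ι) (x y : X) : fiberIdem κ ρ (c, true) x y =
    if κ x = c then (avg ρ - avg κ) x y else 0 := by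
  rw [fiberIdem, fiberDiag_mul_apply]; rfl

theorem fiberIdem_false_ne_zero {c : ι} {x y : X} (hc : κ x = c) (hxy : x ≠ y) (hρ : ρ x = ρ y) :
    fiberIdem κ ρ (c, false) ≠ 0 := by
  intro h0
  have := fiberIdem_apply_false (κ := κ) (ρ := ρ) c x y
  rw [h0] at this
  -- The off-diagonal entry at `(x, y)` is minus the inverse size of the `ρ`-fibre, hence nonzero.
  simp [hc, avg, hxy, hρ] at this
  exact this rfl

theorem fiberIdem_true_ne_zero {c : ι} {x y : X} (hc : κ x = c) (hy : κ y = c) (hρ : ρ x ≠ ρ y) :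
    fiberIdem κ ρ (c, true) ≠ 0 := by
  intro h0
  have := fiberIdem_apply_true (κ := κ) (ρ := ρ) c x y
  rw [h0] at this
  simp [hc, hy, avg, hρ] at this
  exact this hy

/-- Where the `ρ`-fibres are single points, averaging over them is the identity. -/
theorem fiberIdem_false_eq_zero {c : ι} (hc : ∀ x y, κ x = c → ρ x = ρ y → x = y) :
    fiberIdem κ ρ (c, false) = 0 := by
  ext x y
  rw [fiberIdem_apply_false]
  split_ifs with hx
  · have hs : (Finset.univ.filter fun z => ρ z = ρ x) = {x} := by
      ext z; simpa using ⟨fun hz => (hc x z hx hz.symm).symm, fun hz => hz ▸ rfl⟩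
    by_cases hxy : x = y
    · subst hxy; simp [avg, hs]
    · have : ρ x ≠ ρ y := fun hr => hxy (hc x y hx hr)
      simp [avg, hxy, this]
  · rfl

include h in
theorem fiberIdem_true_eq_zero {c : ι} (hc : ∀ x y, κ x = c → κ y = c → ρ x = ρ y) :
    fiberIdem κ ρ (c, true) = 0 := by
  ext x y
  rw [fiberIdem_apply_true]
  split_ifs with hx
  · have hs : ∀ z, ρ z = ρ x ↔ κ z = κ x := fun z =>
      ⟨h z x, fun hz => hc z x (hz.trans hx) hx⟩
    have hs' : ∀ z, ρ x = ρ z ↔ κ x = κ z := fun z => by rw [eq_comm, hs, eq_comm]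
    simp [avg, hs, hs']
  · rfl

end Fibers

/-! ### Ideals generated by central idempotents. -/

theorem isInternal_span_of_complete {R ι : Type*} [Ring R] [Fintype ι] [DecidableEq ι] {F : ι → R}
    (hF : CompleteOrthogonalIdempotents F) : DirectSum.IsInternal fun i => Ideal.span {F i} := by
  have hmem : ∀ i x, x ∈ Ideal.span {F i} → x * F i = x := by
    intro i x hx
    obtain ⟨a, rfl⟩ := Ideal.mem_span_singleton'.1 hx
    rw [mul_assoc, (hF.idem i).eq]
  rw [DirectSum.isInternal_submodule_iff_iSupIndep_and_iSup_eq_top]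
  constructor
  · intro i
    rw [Submodule.disjoint_def]
    intro x hx hx'
    -- Right multiplication by `F i` kills every other summand but fixes the `i`-th one, so the
    -- intersection is zero.
    have hle : ⨆ j, ⨆ _ : j ≠ i, Ideal.span {F j} ≤
        LinearMap.ker (LinearMap.toSpanSingleton R R (F i)) := by
      refine iSup₂_le fun j hj => ?_
      rw [Ideal.span_singleton_le_iff_mem, LinearMap.mem_ker, LinearMap.toSpanSingleton_apply]
      exact hF.ortho hj
    rw [← hmem i x hx]
    exact hle hx'
  · rw [eq_top_iff]
    intro x _
    rw [← mul_one x, ← hF.complete, Finset.mul_sum]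
    exact Submodule.sum_mem _ fun i _ => Submodule.mem_iSup_of_mem i
      (Ideal.mul_mem_left _ _ (Ideal.mem_span_singleton_self _))

theorem isTwoSided_span_of_commute {R : Type*} [Ring R] {f : R} (h : ∀ r, Commute r f) :
    (Ideal.span {f}).IsTwoSided := by
  refine ⟨fun {a} b ha => ?_⟩
  obtain ⟨c, rfl⟩ := Ideal.mem_span_singleton'.1 ha
  rw [mul_assoc, ← (h b).eq, ← mul_assoc]
  exact Ideal.mul_mem_left _ _ (Ideal.mem_span_singleton_self _)

/-- The ideal is the line `K f`, and any nonzero element of a smaller ideal is an invertible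
multiple of `f`. -/
theorem isMinimalTwoSided_span_of_scalar {K R : Type*} [Field K] [Ring R] [Algebra K R] {f : R}
    (hf : f ≠ 0) (hc : ∀ r, Commute r f) (hs : ∀ r : R, ∃ c : K, r * f = c • f) :
    IsMinimalTwoSided (Ideal.span {f}) := by
  refine ⟨⟨isTwoSided_span_of_commute hc, by simpa [Ideal.span_singleton_eq_bot] using hf⟩, ?_⟩
  rintro J ⟨_, hJ0⟩ hJ
  obtain ⟨x, hx, hx0⟩ := Submodule.exists_mem_ne_zero_of_ne_bot hJ0
  obtain ⟨r, hr⟩ := Ideal.mem_span_singleton'.1 (hJ hx)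
  obtain ⟨c, hc⟩ := hs r
  have hxc : x = c • f := hr.symm.trans hc
  have hc0 : c ≠ 0 := by rintro rfl; exact hx0 (by simpa using hxc)
  rw [Ideal.span_singleton_le_iff_mem, show f = c⁻¹ • x by rw [hxc, inv_smul_smul₀ hc0]]
  exact Submodule.smul_of_tower_mem J _ hx

theorem finrank_span_of_scalar {K R : Type*} [Field K] [Ring R] [Algebra K R] {f : R}
    (hf : f ≠ 0) (hs : ∀ r : R, ∃ c : K, r * f = c • f) :
    Module.finrank K (Ideal.span {f}) = 1 := by
  refine finrank_eq_one_iff'.2 ⟨⟨f, Ideal.mem_span_singleton_self f⟩,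
    fun h => hf (congrArg Subtype.val h), ?_⟩
  rintro ⟨w, hw⟩
  obtain ⟨r, rfl⟩ := Ideal.mem_span_singleton'.1 hw
  obtain ⟨c, hc⟩ := hs r
  exact ⟨c, Subtype.ext hc.symm⟩

/-! ### Algebras spanned by block-constant matrices and refining idempotents. -/

section Refining

set_option linter.unusedSectionVars false

variable {X ι τ : Type*} [Fintype X] [DecidableEq X] [Fintype ι] [DecidableEq ι] [Fintype τ]
  [DecidableEq τ]

/-- The idempotents `E i` complete the averaging over the fibers of `κ` to an orthogonal
decomposition of the identity. -/
structure IsRefining (κ : X → ι) (E : τ → Matrix X X ℂ) : Prop where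
  surjective : Function.Surjective κ
  ortho : OrthogonalIdempotents E
  ne_zero : ∀ i, E i ≠ 0
  avg_mul : ∀ i, avg κ * E i = 0
  mul_avg : ∀ i, E i * avg κ = 0
  avg_add_sum : avg κ + ∑ i, E i = 1

/-- The general linear combination of matrices that are constant on blocks and of the `E i`. -/
def blockMap (κ : X → ι) (E : τ → Matrix X X ℂ) :
    Matrix ι ι ℂ × (τ → ℂ) →ₗ[ℂ] Matrix X X ℂ :=
  (inflate κ).coprod (Fintype.linearCombination ℂ E)

theorem blockMap_apply (κ : X → ι) (E : τ → Matrix X X ℂ) (f : Matrix ι ι ℂ) (a : τ → ℂ) :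
    blockMap κ E (f, a) = inflate κ f + ∑ i, a i • E i := rfl

theorem inflate_injective {κ : X → ι} (hκ : Function.Surjective κ) :
    Function.Injective (inflate κ) := by
  intro f g hfg
  ext a b
  obtain ⟨x, rfl⟩ := hκ a
  obtain ⟨y, rfl⟩ := hκ b
  exact congrFun (congrFun hfg x) y

variable {κ : X → ι} {E : τ → Matrix X X ℂ}

namespace IsRefining

variable (h : IsRefining κ E)
include h

theorem sum_smul_mul (a : τ → ℂ) (i : τ) : (∑ j, a j • E j) * E i = a i • E i := by
  rw [Finset.sum_mul, Finset.sum_eq_single i]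
  · rw [smul_mul_assoc, (h.ortho.idem i).eq]
  · intro j _ hj
    rw [smul_mul_assoc, h.ortho.ortho hj, smul_zero]
  · simp

theorem mul_sum_smul (a : τ → ℂ) (i : τ) : E i * (∑ j, a j • E j) = a i • E i := by
  rw [Finset.mul_sum, Finset.sum_eq_single i]
  · rw [mul_smul_comm, (h.ortho.idem i).eq]
  · intro j _ hj
    rw [mul_smul_comm, h.ortho.ortho hj.symm, smul_zero]
  · simp

theorem blockMap_mul_idem (v : Matrix ι ι ℂ × (τ → ℂ)) (i : τ) :
    blockMap κ E v * E i = v.2 i • E i := by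
  rw [← Prod.mk.eta (p := v), blockMap_apply, add_mul, inflate_mul_eq_zero (h.avg_mul i),
    h.sum_smul_mul, zero_add]

theorem idem_mul_blockMap (v : Matrix ι ι ℂ × (τ → ℂ)) (i : τ) :
    E i * blockMap κ E v = v.2 i • E i := by
  rw [← Prod.mk.eta (p := v), blockMap_apply, mul_add, mul_inflate_eq_zero (h.mul_avg i),
    h.mul_sum_smul, zero_add]

theorem blockMap_mul_avg (v : Matrix ι ι ℂ × (τ → ℂ)) :
    blockMap κ E v * avg κ = inflate κ v.1 := by
  rw [← Prod.mk.eta (p := v), blockMap_apply, add_mul, inflate_mul_avg, Finset.sum_mul,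
    Finset.sum_eq_zero, add_zero]
  intro i _
  rw [smul_mul_assoc, h.mul_avg, smul_zero]

theorem avg_mul_blockMap (v : Matrix ι ι ℂ × (τ → ℂ)) :
    avg κ * blockMap κ E v = inflate κ v.1 := by
  rw [← Prod.mk.eta (p := v), blockMap_apply, mul_add, avg_mul_inflate, Finset.mul_sum,
    Finset.sum_eq_zero, add_zero]
  intro i _
  rw [mul_smul_comm, h.avg_mul, smul_zero]

theorem inflate_mem_range (f : Matrix ι ι ℂ) : inflate κ f ∈ LinearMap.range (blockMap κ E) :=
  ⟨(f, 0), by simp [blockMap_apply]⟩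

theorem idem_mem_range (i : τ) : E i ∈ LinearMap.range (blockMap κ E) :=
  ⟨(0, Pi.single i 1), by simp [blockMap_apply, Pi.single_apply]⟩

theorem avg_mem_range : avg κ ∈ LinearMap.range (blockMap κ E) := by
  obtain ⟨p, hp⟩ := exists_inflate_eq_avg h.surjective
  exact hp ▸ h.inflate_mem_range p

theorem one_mem_range : 1 ∈ LinearMap.range (blockMap κ E) := by
  rw [← h.avg_add_sum]
  exact add_mem h.avg_mem_range (sum_mem fun i _ => h.idem_mem_range i)

theorem mul_mem_range {M N : Matrix X X ℂ} (hM : M ∈ LinearMap.range (blockMap κ E))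
    (hN : N ∈ LinearMap.range (blockMap κ E)) : M * N ∈ LinearMap.range (blockMap κ E) := by
  obtain ⟨v, rfl⟩ := hM
  obtain ⟨⟨g, b⟩, rfl⟩ := hN
  -- Inserting `avg κ` before `inflate κ g` removes the idempotent part of the left factor and
  -- leaves a product of two inflations.
  rw [blockMap_apply κ E g b, mul_add, ← avg_mul_inflate κ g, ← mul_assoc, h.blockMap_mul_avg,
    inflate_mul_inflate, Finset.mul_sum]
  refine add_mem (h.inflate_mem_range _) (sum_mem fun i _ => ?_)
  rw [mul_smul_comm, h.blockMap_mul_idem]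
  exact Submodule.smul_mem _ _ (Submodule.smul_mem _ _ (h.idem_mem_range i))

/-- Multiplying by `avg κ` recovers the block part, and multiplying by `E i` recovers the `i`-th
scalar. -/
theorem blockMap_injective : Function.Injective (blockMap κ E) := by
  intro v w hvw
  refine Prod.ext (inflate_injective h.surjective ?_) (funext fun i => ?_)
  · rw [← h.blockMap_mul_avg, hvw, h.blockMap_mul_avg]
  · refine smul_left_injective ℂ (h.ne_zero i) ?_
    change v.2 i • E i = w.2 i • E i
    rw [← h.blockMap_mul_idem, hvw, h.blockMap_mul_idem]

variable {T : Subalgebra ℂ (Matrix X X ℂ)}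
  (hT : Subalgebra.toSubmodule T = LinearMap.range (blockMap κ E))
include hT

theorem mem_iff (M : Matrix X X ℂ) : M ∈ T ↔ M ∈ LinearMap.range (blockMap κ E) := by
  rw [← hT, Subalgebra.mem_toSubmodule]

theorem finrank_eq : Module.finrank ℂ T = Fintype.card ι ^ 2 + Fintype.card τ := by
  rw [← Subalgebra.finrank_toSubmodule, hT, LinearMap.finrank_range_of_inj h.blockMap_injective,
    Module.finrank_prod, Module.finrank_matrix, Module.finrank_fintype_fun_eq_card,
    Module.finrank_self, mul_one, sq]

/-- The averaging matrix, as an element of the algebra. -/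
noncomputable def avgElem : T := ⟨avg κ, (h.mem_iff hT _).2 h.avg_mem_range⟩

/-- The idempotent `E i`, as an element of the algebra. -/
def idemElem (i : τ) : T := ⟨E i, (h.mem_iff hT _).2 (h.idem_mem_range i)⟩

/-- The inflated matrices, as elements of the algebra. -/
def inflateElem : Matrix ι ι ℂ →ₗ[ℂ] T :=
  (inflate κ).codRestrict (Subalgebra.toSubmodule T) fun f =>
    (h.mem_iff hT _).2 (h.inflate_mem_range f)

theorem exists_blockMap (t : T) : ∃ v, blockMap κ E v = t := (h.mem_iff hT _).1 t.2

theorem complete : CompleteOrthogonalIdempotents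
    (fun o : Option τ => o.elim (h.avgElem hT) (h.idemElem hT)) where
  idem o := by
    cases o with
    | none => exact Subtype.ext (avg_mul_self κ)
    | some i => exact Subtype.ext (h.ortho.idem i)
  ortho o o' hne := by
    cases o <;> cases o'
    · exact absurd rfl hne
    · exact Subtype.ext (h.avg_mul _)
    · exact Subtype.ext (h.mul_avg _)
    · exact Subtype.ext (h.ortho.ortho fun hh => hne (congrArg some hh))
  complete := by
    rw [Fintype.sum_option]
    refine Subtype.ext ?_
    simpa [idemElem, avgElem] using h.avg_add_sum

theorem commute_avgElem (t : T) : Commute t (h.avgElem hT) := by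
  obtain ⟨v, hv⟩ := h.exists_blockMap hT t
  refine Subtype.ext ?_
  change (t : Matrix X X ℂ) * avg κ = avg κ * t
  rw [← hv, h.blockMap_mul_avg, h.avg_mul_blockMap]

theorem commute_idemElem (i : τ) (t : T) : Commute t (h.idemElem hT i) := by
  obtain ⟨v, hv⟩ := h.exists_blockMap hT t
  refine Subtype.ext ?_
  change (t : Matrix X X ℂ) * E i = E i * t
  rw [← hv, h.blockMap_mul_idem, h.idem_mul_blockMap]

theorem exists_mul_idemElem (i : τ) (t : T) : ∃ c : ℂ, t * h.idemElem hT i = c • h.idemElem hT i := by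
  obtain ⟨v, hv⟩ := h.exists_blockMap hT t
  refine ⟨v.2 i, Subtype.ext ?_⟩
  change (t : Matrix X X ℂ) * E i = v.2 i • E i
  rw [← hv, h.blockMap_mul_idem]

theorem idemElem_ne_zero (i : τ) : h.idemElem hT i ≠ 0 :=
  fun h0 => h.ne_zero i (congrArg Subtype.val h0)

theorem inflateElem_mem (f : Matrix ι ι ℂ) : h.inflateElem hT f ∈ Ideal.span {h.avgElem hT} :=
  Ideal.mem_span_singleton'.2 ⟨h.inflateElem hT f, Subtype.ext (inflate_mul_avg κ f)⟩

theorem exists_inflateElem {x : T} (hx : x ∈ Ideal.span {h.avgElem hT}) :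
    ∃ f, h.inflateElem hT f = x := by
  obtain ⟨t, rfl⟩ := Ideal.mem_span_singleton'.1 hx
  obtain ⟨v, hv⟩ := h.exists_blockMap hT t
  refine ⟨v.1, Subtype.ext ?_⟩
  change inflate κ v.1 = t * avg κ
  rw [← hv, h.blockMap_mul_avg]

theorem finrank_avgIdeal :
    Module.finrank ℂ (Ideal.span {h.avgElem hT}) = Fintype.card ι ^ 2 := by
  let φ : Matrix ι ι ℂ →ₗ[ℂ] Ideal.span {h.avgElem hT} :=
    { toFun f := ⟨h.inflateElem hT f, h.inflateElem_mem hT f⟩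
      map_add' f g := Subtype.ext ((h.inflateElem hT).map_add f g)
      map_smul' c f := Subtype.ext ((h.inflateElem hT).map_smul c f) }
  have hφ : Function.Bijective φ := by
    constructor
    · intro f g hfg
      have hfg' : ((φ f : T) : Matrix X X ℂ) = (φ g : T) := by rw [hfg]
      exact inflate_injective h.surjective hfg'
    · rintro ⟨x, hx⟩
      obtain ⟨f, hf⟩ := h.exists_inflateElem hT hx
      exact ⟨f, Subtype.ext hf⟩
  rw [← (LinearEquiv.ofBijective φ hφ).finrank_eq, Module.finrank_matrix, Module.finrank_self,
    mul_one, sq]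

/-- This is the simplicity of a full matrix algebra, proved with matrix units for the product
twisted by fibre sizes. -/
theorem isMinimalTwoSided_avgIdeal [Nonempty ι] :
    IsMinimalTwoSided (Ideal.span {h.avgElem hT}) := by
  refine ⟨⟨isTwoSided_span_of_commute (h.commute_avgElem hT), ?_⟩, ?_⟩
  · intro h0
    obtain ⟨a⟩ := ‹Nonempty ι›
    have h1 : h.inflateElem hT (Matrix.single a a 1) = 0 := by
      simpa [h0] using h.inflateElem_mem hT (Matrix.single a a 1)
    have h2 : Matrix.single a a (1 : ℂ) = 0 := by
      refine inflate_injective h.surjective ?_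
      rw [map_zero]
      exact congrArg Subtype.val h1
    simpa using congrFun (congrFun h2 a) a
  rintro J ⟨_, hJ0⟩ hJ
  obtain ⟨x, hx, hx0⟩ := Submodule.exists_mem_ne_zero_of_ne_bot hJ0
  obtain ⟨f, rfl⟩ := h.exists_inflateElem hT (hJ hx)
  have hf : ∃ c d, f c d ≠ 0 := by
    by_contra! hf
    exact hx0 (by rw [show f = 0 from Matrix.ext hf, map_zero])
  obtain ⟨c, d, hcd⟩ := hf
  have hcard : ∀ a : ι, ((Finset.univ.filter fun z => κ z = a).card : ℂ) ≠ 0 := by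
    intro a
    obtain ⟨x, rfl⟩ := h.surjective a
    exact fiber_card_ne_zero κ x
  have hunit : ∀ a b : ι, ∀ r : ℂ, h.inflateElem hT (Matrix.single a b r) ∈ J := by
    intro a b r
    have hmem := Ideal.IsTwoSided.mul_mem_of_left (I := J) (h.inflateElem hT (Matrix.single d b 1))
      (J.mul_mem_left (h.inflateElem hT (Matrix.single a c 1)) hx)
    -- The twisted product `e_{ac} f e_{db}` equals `s e_{ab}`: the entry `f c d` picks up the fibre
    -- sizes at `c` and at `d`, both nonzero.
    set s : ℂ := (Finset.univ.filter fun z => κ z = c).card * f c d *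
      (Finset.univ.filter fun z => κ z = d).card with hs
    have hs0 : s ≠ 0 := mul_ne_zero (mul_ne_zero (hcard c) hcd) (hcard d)
    have heq : h.inflateElem hT (Matrix.single a b r) = (r * s⁻¹) •
        (h.inflateElem hT (Matrix.single a c 1) * h.inflateElem hT f *
          h.inflateElem hT (Matrix.single d b 1)) := by
      refine Subtype.ext ?_
      change inflate κ _ = (r * s⁻¹) • (inflate κ _ * inflate κ f * inflate κ _)
      rw [inflate_mul_inflate, inflate_mul_inflate, ← map_smul]
      congr 1
      set D := Matrix.diagonal fun c : ι => ((Finset.univ.filter fun z => κ z = c).card : ℂ)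
        with hD
      rw [show Matrix.single a c 1 * D * f * D * Matrix.single d b 1 =
        Matrix.single a c 1 * (D * f * D) * Matrix.single d b 1 by simp only [mul_assoc],
        Matrix.single_mul_mul_single, hD, Matrix.mul_diagonal, Matrix.diagonal_mul,
        Matrix.smul_single]
      simp [← hs, hs0]
    rw [heq]
    exact Submodule.smul_of_tower_mem J _ hmem
  have hall : ∀ g, h.inflateElem hT g ∈ J := by
    intro g
    rw [Matrix.matrix_eq_sum_single g, map_sum]
    refine sum_mem fun a _ => ?_
    rw [map_sum]
    exact sum_mem fun b _ => hunit a b _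
  rw [Ideal.span_singleton_le_iff_mem]
  obtain ⟨p, hp⟩ := exists_inflate_eq_avg h.surjective
  have : h.inflateElem hT p = h.avgElem hT := Subtype.ext hp
  exact this ▸ hall p

theorem isWedderburnDecomposition [Nonempty ι] : IsWedderburnDecomposition
    (fun o : Option τ => o.elim (Ideal.span {h.avgElem hT})
      fun i => Ideal.span {h.idemElem hT i}) := by
  have heq : (fun o : Option τ => o.elim (Ideal.span {h.avgElem hT})
      fun i => Ideal.span {h.idemElem hT i}) =
      fun o => Ideal.span {o.elim (h.avgElem hT) (h.idemElem hT)} := by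
    funext o; cases o <;> rfl
  refine ⟨?_, heq ▸ isInternal_span_of_complete (h.complete hT)⟩
  rintro (_ | i)
  · exact h.isMinimalTwoSided_avgIdeal hT
  · exact isMinimalTwoSided_span_of_scalar (h.idemElem_ne_zero hT i) (h.commute_idemElem hT i)
      (h.exists_mul_idemElem hT i)

end IsRefining

end Refining

/-! ### Finite computations in `Q₈` and in `GL₂(𝔽₃)`. -/

/-- The colouring of the quaternion group by conjugacy class; the colours start with `1`. -/
def quatColor : QuaternionGroup 2 → Fin 6
  | .a i => if i = 0 then 1 else if i = 2 then 2 else 3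
  | .xa i => if i = 0 ∨ i = 2 then 4 else 5

theorem quatColor_eq_iff : ∀ q r : QuaternionGroup 2,
    quatColor q = quatColor r ↔ ∃ s, s * q * s⁻¹ = r := by decide +kernel

theorem quatColor_ne_zero : ∀ q, quatColor q ≠ 0 := by decide +kernel

theorem quatColor_eq_one : ∀ q, quatColor q = 1 ↔ q = 1 := by decide +kernel

/-- The colour of `r * q⁻¹` in terms of the colours of `q` and `r` when these are different. -/
def quatDiff (c d : Fin 6) : Fin 6 :=
  -- Colour `0` shares the representative `1` with colour `1`, because the identity of `G` also
  -- projects to `1`; one table then serves all colours.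
  let rep : Fin 6 → QuaternionGroup 2 := ![1, 1, .a 2, .a 1, .xa 0, .xa 1]
  quatColor (rep d * (rep c)⁻¹)

/-- The classes of `Q₈` are `{1}`, `{-1}` and pairs `{q, -q}`. Two distinct elements of one class
thus have quotient `-1`, and for different classes a change of sign inside a class does not move the
class of the quotient. -/
theorem quatColor_mul_inv : ∀ q r : QuaternionGroup 2, quatColor (r * q⁻¹) =
    if q = r then 1 else if quatColor q = quatColor r then 2 else
      quatDiff (quatColor q) (quatColor r) := by decide +kernel

theorem quat_sq_or : ∀ q : QuaternionGroup 2, q = 1 ∨ q = QuaternionGroup.a 2 ∨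
    q ^ 2 = QuaternionGroup.a 2 := by decide +kernel

/-- The square of such a map has determinant `1`, and the only involution of determinant `1` in
`GL₂(𝔽₃)` is `-1`. -/
theorem sq_eq_neg_of_pow_four : ∀ u v : ZMod 3 × ZMod 3,
    let f : ZMod 3 × ZMod 3 → ZMod 3 × ZMod 3 :=
      fun n => (n.1 * u.1 + n.2 * v.1, n.1 * u.2 + n.2 * v.2)
    (∀ n, f (f (f (f n))) = n) → (∀ n, f (f n) = n) ∨ ∀ n, f (f n) = -n := by decide +kernel

/-! ### Conjugacy classes of the Frobenius group. -/

section Semidirect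

variable {φ : QuaternionGroup 2 →* MulAut (Multiplicative (ZMod 3 × ZMod 3))}

open Multiplicative in
theorem mulAut_coords (σ : MulAut (Multiplicative (ZMod 3 × ZMod 3))) :
    ∃ u v : ZMod 3 × ZMod 3, ∀ n : ZMod 3 × ZMod 3,
      σ (ofAdd n) = ofAdd (n.1 * u.1 + n.2 * v.1, n.1 * u.2 + n.2 * v.2) := by
  let L : ZMod 3 × ZMod 3 →ₗ[ZMod 3] ZMod 3 × ZMod 3 :=
    AddMonoidHom.toZModLinearMap 3
      (AddMonoidHom.mk' (fun n => toAdd (σ (ofAdd n))) fun a b => by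
        rw [ofAdd_add, map_mul, toAdd_mul])
  refine ⟨L (1, 0), L (0, 1), fun n => ?_⟩
  change L n = _
  have hn : n = n.1 • ((1, 0) : ZMod 3 × ZMod 3) + n.2 • ((0, 1) : ZMod 3 × ZMod 3) := by
    ext <;> simp
  conv_lhs => rw [hn, map_add, map_smul, map_smul]
  rfl

/-- `a 2` is the square of `a 1`, which has order four. By faithfulness it does not act trivially,
so it acts as `-1`. -/
theorem apply_a_two (hφ : Function.Injective φ) (n : Multiplicative (ZMod 3 × ZMod 3)) :
    φ (.a 2) n = n⁻¹ := by
  obtain ⟨u, v, hf⟩ := mulAut_coords (φ (.a 1))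
  have h2 : ∀ m, φ (.a 2) m = φ (.a 1) (φ (.a 1) m) := fun m => by
    rw [← MulAut.mul_apply, ← map_mul]; rfl
  have h4 : ∀ m, φ (.a 1) (φ (.a 1) (φ (.a 1) (φ (.a 1) m))) = m := fun m => by
    rw [← h2, ← h2, ← MulAut.mul_apply, ← map_mul,
      show (QuaternionGroup.a 2 * QuaternionGroup.a 2 : QuaternionGroup 2) = 1 by decide, map_one,
      MulAut.one_apply]
  have key := sq_eq_neg_of_pow_four u v fun m => by
    have := h4 (Multiplicative.ofAdd m)
    rwa [hf, hf, hf, hf] at this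
  rcases key with key | key
  · exfalso
    have h1 : φ (.a 2) = φ 1 := by
      refine MulEquiv.ext fun m => ?_
      have := key m.toAdd
      rw [map_one, MulAut.one_apply, h2, ← ofAdd_toAdd m, hf, hf]
      exact congrArg Multiplicative.ofAdd this
    exact absurd (hφ h1) (by decide)
  · rw [h2, ← ofAdd_toAdd n, hf, hf]
    exact congrArg Multiplicative.ofAdd (key n.toAdd)

theorem eq_one_of_inv_eq_self :
    ∀ n : Multiplicative (ZMod 3 × ZMod 3), n⁻¹ = n → n = 1 := by decide +kernel

/-- Every nontrivial `q` has `a 2` among its powers, so a fixed point of `q` is fixed by inversion,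
which forces it to be trivial in a group of exponent three. -/
theorem eq_one_of_fixed (hφ : Function.Injective φ) {q : QuaternionGroup 2} (hq : q ≠ 1)
    {n : Multiplicative (ZMod 3 × ZMod 3)} (hn : φ q n = n) : n = 1 := by
  apply eq_one_of_inv_eq_self
  rw [← apply_a_two hφ]
  rcases quat_sq_or q with h | h | h
  · exact absurd h hq
  · rw [← h, hn]
  · rw [← h, sq, map_mul, MulAut.mul_apply, hn, hn]

/-- The orbit map of `n` is injective by freeness, and `Q₈` and `N \ {1}` both have eight elements.
-/
theorem exists_aut_eq (hφ : Function.Injective φ) {n m : Multiplicative (ZMod 3 × ZMod 3)}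
    (hn : n ≠ 1) (hm : m ≠ 1) : ∃ s, φ s n = m := by
  let g : QuaternionGroup 2 → {m : Multiplicative (ZMod 3 × ZMod 3) // m ≠ 1} :=
    fun s => ⟨φ s n, fun h => hn ((map_eq_one_iff _ (φ s).injective).1 h)⟩
  have hg : Function.Injective g := by
    intro s t hst
    have hst' : φ s n = φ t n := congrArg Subtype.val hst
    by_contra hne
    refine hn (eq_one_of_fixed hφ (q := t⁻¹ * s) (fun h => hne (inv_mul_eq_one.1 h).symm) ?_)
    rw [map_mul, MulAut.mul_apply, hst', map_inv, MulAut.inv_apply_self]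
  have hb := (Fintype.bijective_iff_injective_and_card g).2 ⟨hg, by decide +kernel⟩
  obtain ⟨s, hs⟩ := hb.2 ⟨m, hm⟩
  exact ⟨s, congrArg Subtype.val hs⟩

/-- Conjugation by `N` acts on the `N`-part of an element over `q` by this map. It is injective
since `φ q` has no nontrivial fixed point, hence surjective on a finite set, so a coset over `q ≠ 1`
lies in one class. -/
theorem exists_twisted_conj_eq (hφ : Function.Injective φ) {q : QuaternionGroup 2} (hq : q ≠ 1)
    (n m : Multiplicative (ZMod 3 × ZMod 3)) : ∃ k, k * n * φ q k⁻¹ = m := by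
  have hi : Function.Injective fun k => k * n * φ q k⁻¹ := by
    intro k l hkl
    have hkl' : k * n * φ q k⁻¹ = l * n * φ q l⁻¹ := hkl
    rw [map_inv, map_inv, mul_inv_eq_iff_eq_mul] at hkl'
    rw [← inv_mul_eq_one]
    refine inv_eq_one.1 (eq_one_of_fixed hφ hq ?_)
    rw [mul_inv_rev, inv_inv, map_mul, map_inv, eq_inv_mul_iff_mul_eq]
    refine mul_right_cancel (b := n) ?_
    rw [hkl']
    ac_rfl
  exact (Finite.injective_iff_surjective.1 hi) m

/-- The colouring of a group over the quaternion group, where the identity is given its own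
colour. -/
def gpColor {G : Type*} [Group G] [DecidableEq G] (π : G →* QuaternionGroup 2) (g : G) : Fin 6 :=
  if g = 1 then 0 else quatColor (π g)

open SemidirectProduct in
theorem semidirect_exists_conj (hφ : Function.Injective φ)
    {x y : Multiplicative (ZMod 3 × ZMod 3) ⋊[φ] QuaternionGroup 2} (hx : x ≠ 1) (hy : y ≠ 1)
    (h : quatColor x.right = quatColor y.right) : IsConj x y := by
  obtain ⟨s, hs⟩ := (quatColor_eq_iff _ _).1 h
  have hxx : IsConj x (inr s * x * (inr s)⁻¹) := isConj_iff.2 ⟨_, rfl⟩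
  -- After conjugation by a complement element the two `Q₈`-parts agree. It remains to match the
  -- `N`-parts, by `Q₈` over the trivial element and by `N` elsewhere.
  refine hxx.trans ?_
  have hx' : inr s * x * (inr s)⁻¹ ≠ 1 := fun h1 => hx (by simpa [conj_eq_one_iff] using h1)
  have hr : (inr s * x * (inr s)⁻¹).right = y.right := by simpa using hs
  generalize inr s * x * (inr s)⁻¹ = z at hx' hr
  rw [isConj_iff]
  by_cases hq : y.right = 1
  · have hz1 : z.left ≠ 1 := fun hl => hx' (SemidirectProduct.ext hl (hr.trans hq))
    have hy1 : y.left ≠ 1 := fun hl => hy (SemidirectProduct.ext hl hq)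
    obtain ⟨t, ht⟩ := exists_aut_eq hφ hz1 hy1
    refine ⟨inr t, SemidirectProduct.ext ?_ ?_⟩
    · simpa using ht
    · simp [hr, hq]
  · obtain ⟨k, hk⟩ := exists_twisted_conj_eq hφ (hr ▸ hq) z.left y.left
    refine ⟨inl k, SemidirectProduct.ext ?_ ?_⟩
    · simpa using hk
    · simpa using hr

theorem isConj_iff_gpColor (hφ : Function.Injective φ) {G : Type*} [Group G] [DecidableEq G]
    (e : G ≃* Multiplicative (ZMod 3 × ZMod 3) ⋊[φ] QuaternionGroup 2) (x y : G) :
    IsConj x y ↔ gpColor (SemidirectProduct.rightHom.comp e.toMonoidHom) x =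
      gpColor (SemidirectProduct.rightHom.comp e.toMonoidHom) y := by
  constructor
  · intro h
    obtain ⟨c, rfl⟩ := isConj_iff.1 h
    simp only [gpColor, conj_eq_one_iff]
    split_ifs
    · rfl
    · exact (quatColor_eq_iff _ _).2 ⟨SemidirectProduct.rightHom (e c), by simp⟩
  · intro h
    unfold gpColor at h
    split_ifs at h with hx hy hy
    · rw [hx, hy]
    · exact absurd h.symm (quatColor_ne_zero _)
    · exact absurd h (quatColor_ne_zero _)
    · have := semidirect_exists_conj hφ (x := e x) (y := e y) (by simpa using hx)
        (by simpa using hy) h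
      obtain ⟨c, hc⟩ := isConj_iff.1 this
      refine isConj_iff.2 ⟨e.symm c, e.injective ?_⟩
      simpa using hc

end Semidirect

/-! ### Which refining idempotents survive. -/

theorem exists_quatColor_eq : ∀ c : Fin 6, 2 ≤ c → ∃ q, q ≠ 1 ∧ quatColor q = c := by
  decide +kernel

theorem exists_pair_quatColor_eq : ∀ c : Fin 6, 3 ≤ c →
    ∃ q r, q ≠ 1 ∧ r ≠ 1 ∧ q ≠ r ∧ quatColor q = c ∧ quatColor r = c := by
  decide +kernel

theorem quatColor_injOn : ∀ q r, quatColor q ≤ 2 → quatColor q = quatColor r → q = r := by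
  decide +kernel

theorem quatDiff_zero_left : ∀ q, quatDiff 0 (quatColor q) = quatColor q := by decide +kernel

theorem quatDiff_zero_right : ∀ q, quatDiff (quatColor q) 0 = quatColor q⁻¹ := by decide +kernel

/-- The positions of the refining idempotents that do not vanish. -/
def refiningIndex : Fin 8 → Fin 6 × Bool :=
  ![(1, false), (2, false), (3, false), (4, false), (5, false), (3, true), (4, true), (5, true)]

theorem refiningIndex_injective : Function.Injective refiningIndex := by decide +kernel

theorem refiningIndex_cases : ∀ i, (∃ c, 1 ≤ c ∧ refiningIndex i = (c, false)) ∨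
    ∃ c, 3 ≤ c ∧ refiningIndex i = (c, true) := by decide +kernel

theorem notMem_range_refiningIndex : ∀ p, (∀ i, refiningIndex i ≠ p) →
    p = (0, false) ∨ ∃ c, c ≤ 2 ∧ p = (c, true) := by decide +kernel

/-! ### The colouring of `G`, and the Terwilliger algebra in terms of it. -/

section Coloring

variable {G : Type*} [Group G] [DecidableEq G] (π : G →* QuaternionGroup 2)

/-- The colouring by conjugacy class refined by the projection to the quaternion group. -/
def gpFine (x : G) : Fin 6 × QuaternionGroup 2 := (gpColor π x, π x)

/-- The `0`-`1` matrix of the pairs `(x, y)` for which `y * x⁻¹` has colour `j`. -/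
def colorAdj (j : Fin 6) : Matrix G G ℂ :=
  Matrix.of fun x y => if gpColor π (y * x⁻¹) = j then 1 else 0

/-- The `0`-`1` matrix of the equivalence relation given by the fine colouring. -/
def fineRel : Matrix G G ℂ :=
  Matrix.of fun x y => if gpFine π x = gpFine π y then 1 else 0

/-- A projection to the quaternion group with large kernel, for which the colouring classifies
the conjugacy classes. -/
structure IsClassColoring : Prop where
  surjective : Function.Surjective π
  isConj_iff : ∀ x y : G, IsConj x y ↔ gpColor π x = gpColor π y
  exists_ker : ∃ u v : G, u ≠ 1 ∧ v ≠ 1 ∧ u ≠ v ∧ π u = 1 ∧ π v = 1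

variable {π}

theorem gpColor_one : gpColor π 1 = 0 := if_pos rfl

theorem gpColor_of_ne {x : G} (hx : x ≠ 1) : gpColor π x = quatColor (π x) := if_neg hx

theorem gpColor_of_map_ne {x : G} (hx : π x ≠ 1) : gpColor π x = quatColor (π x) :=
  gpColor_of_ne fun h => hx (by rw [h, map_one])

theorem gpColor_eq_zero {x : G} : gpColor π x = 0 ↔ x = 1 := by
  unfold gpColor
  split_ifs with h
  · simp [h]
  · simp [h, quatColor_ne_zero]

theorem gpFine_eq {x y : G} (hxy : gpFine π x = gpFine π y) : gpColor π x = gpColor π y :=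
  congrArg Prod.fst hxy

/-- This reduces to `quatColor_mul_inv` through `π`; the identity of `G` is treated apart since it
alone has colour `0`. -/
theorem gpColor_mul_inv (x y : G) : gpColor π (y * x⁻¹) =
    if gpColor π x = gpColor π y then (if x = y then 0 else if π x = π y then 1 else 2)
    else quatDiff (gpColor π x) (gpColor π y) := by
  by_cases hxy : x = y
  · simp [hxy, gpColor]
  have hne : y * x⁻¹ ≠ 1 := fun h => hxy (mul_inv_eq_one.1 h).symm
  rw [gpColor_of_ne hne, map_mul, map_inv]
  by_cases hx : x = 1
  · subst hx
    have hy : y ≠ 1 := Ne.symm hxy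
    have h0 : gpColor π 1 ≠ gpColor π y := fun h => hy (gpColor_eq_zero.1 (h ▸ gpColor_one))
    rw [if_neg h0, gpColor_one, gpColor_of_ne hy, quatDiff_zero_left, map_one, inv_one, mul_one]
  by_cases hy : y = 1
  · subst hy
    have h0 : gpColor π x ≠ gpColor π 1 := fun h => hx (gpColor_eq_zero.1 (h.trans gpColor_one))
    rw [if_neg h0, gpColor_one, gpColor_of_ne hx, quatDiff_zero_right, map_one, one_mul]
  rw [quatColor_mul_inv, gpColor_of_ne hx, gpColor_of_ne hy]
  by_cases hq : π x = π y
  · simp [hq, hxy]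
  · simp [hq, hxy]

theorem map_eq_of_gpColor_le {c : Fin 6} (hc : c ≤ 2) {x y : G} (hx : gpColor π x = c)
    (hy : gpColor π y = c) : π x = π y := by
  by_cases hx1 : x = 1
  · subst hx1
    rw [gpColor_one] at hx
    rw [gpColor_eq_zero.1 (hy.trans hx.symm)]
  by_cases hy1 : y = 1
  · subst hy1
    rw [gpColor_one] at hy
    rw [gpColor_eq_zero.1 (hx.trans hy.symm)]
  rw [gpColor_of_ne hx1] at hx
  rw [gpColor_of_ne hy1] at hy
  exact quatColor_injOn _ _ (hx ▸ hc) (hx.trans hy.symm)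

namespace IsClassColoring

variable (h : IsClassColoring π)
include h

theorem gpColor_surjective : Function.Surjective (gpColor π) := by
  intro c
  obtain ⟨u, -, hu, -, -, hπu, -⟩ := h.exists_ker
  by_cases hc : 2 ≤ c
  · obtain ⟨q, hq, hqc⟩ := exists_quatColor_eq c hc
    obtain ⟨x, rfl⟩ := h.surjective q
    exact ⟨x, (gpColor_of_map_ne hq).trans hqc⟩
  · have : c = 0 ∨ c = 1 := by revert c; decide
    rcases this with rfl | rfl
    · exact ⟨1, gpColor_one⟩
    · exact ⟨u, (gpColor_of_ne hu).trans ((quatColor_eq_one _).2 hπu)⟩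

theorem card_conjClasses : Nat.card (ConjClasses G) = 6 := by
  let g : ConjClasses G → Fin 6 := Quotient.lift (gpColor π) fun x y hxy => (h.isConj_iff x y).1 hxy
  have hg : Function.Bijective g := by
    constructor
    · intro a b
      obtain ⟨a, rfl⟩ := ConjClasses.exists_rep a
      obtain ⟨b, rfl⟩ := ConjClasses.exists_rep b
      exact fun hab => ConjClasses.mk_eq_mk_iff_isConj.2 ((h.isConj_iff _ _).2 hab)
    · intro c
      obtain ⟨x, rfl⟩ := h.gpColor_surjective c
      exact ⟨ConjClasses.mk x, rfl⟩
  rw [Nat.card_eq_of_bijective g hg, Nat.card_eq_fintype_card, Fintype.card_fin]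

theorem adjMatrix_mk (g : G) : adjMatrix (ConjClasses.mk g) = colorAdj π (gpColor π g) := by
  ext x y
  simp only [adjMatrix, colorAdj, Matrix.of_apply, ConjClasses.mem_carrier_iff_mk_eq,
    ConjClasses.mk_eq_mk_iff_isConj, h.isConj_iff]

theorem dualIdempotent_mk (g : G) :
    dualIdempotent (ConjClasses.mk g) = fiberDiag (gpColor π) (gpColor π g) := by
  rw [dualIdempotent, h.adjMatrix_mk]
  simp [colorAdj, fiberDiag]

variable [Fintype G]

theorem colorAdj_mem (j : Fin 6) : colorAdj π j ∈ terwilliger G := by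
  obtain ⟨g, rfl⟩ := h.gpColor_surjective j
  rw [← h.adjMatrix_mk]
  exact Algebra.subset_adjoin (Or.inl (Submodule.subset_span ⟨_, rfl⟩))

theorem fiberDiag_mem (c : Fin 6) : fiberDiag (gpColor π) c ∈ terwilliger G := by
  obtain ⟨g, rfl⟩ := h.gpColor_surjective c
  rw [← h.dualIdempotent_mk]
  exact Algebra.subset_adjoin (Or.inr (Submodule.subset_span ⟨_, rfl⟩))

omit h [Fintype G] in
theorem sum_colorAdj (x y : G) : (∑ j, colorAdj π j) x y = 1 := by
  simp [Matrix.sum_apply, colorAdj]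

theorem inflate_mem (f : Matrix (Fin 6) (Fin 6) ℂ) : inflate (gpColor π) f ∈ terwilliger G := by
  -- The adjacency matrices sum to the all-ones matrix, which the dual idempotents cut into blocks.
  have : inflate (gpColor π) f = ∑ c, ∑ d, f c d •
      (fiberDiag (gpColor π) c * (∑ j, colorAdj π j) * fiberDiag (gpColor π) d) := by
    ext x y
    simp only [Matrix.sum_apply, Matrix.smul_apply, mul_fiberDiag_apply, fiberDiag_mul_apply,
      inflate_apply]
    simp only [← Matrix.sum_apply, sum_colorAdj]
    simp
  rw [this]
  exact sum_mem fun c _ => sum_mem fun d _ => Subalgebra.smul_mem _ (mul_mem (mul_mem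
    (h.fiberDiag_mem c) (sum_mem fun j _ => h.colorAdj_mem j)) (h.fiberDiag_mem d)) _

theorem fineRel_mem : fineRel π ∈ terwilliger G := by
  -- `A₀ + A₁` is the relation "same coset of `N`"; the dual idempotents restrict it to pairs of
  -- equal colour.
  have : fineRel π = ∑ c,
      (fiberDiag (gpColor π) c * (colorAdj π 0 + colorAdj π 1) * fiberDiag (gpColor π) c) := by
    ext x y
    simp only [Matrix.sum_apply, mul_fiberDiag_apply, fiberDiag_mul_apply, Finset.sum_ite_eq,
      Finset.mem_univ, if_true, Matrix.add_apply, colorAdj, fineRel, Matrix.of_apply, gpFine,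
      Prod.mk.injEq, gpColor_mul_inv]
    by_cases hc : gpColor π x = gpColor π y
    · by_cases hxy : x = y
      · simp [hxy]
      · by_cases hq : π x = π y <;> simp [hc, hxy, hq]
    · simp [hc]
  rw [this]
  exact sum_mem fun c _ => mul_mem (mul_mem (h.fiberDiag_mem c)
    (add_mem (h.colorAdj_mem 0) (h.colorAdj_mem 1))) (h.fiberDiag_mem c)

/-- Conjugation permutes the fine fibres and is transitive on each colour, so fibre size depends on
colour alone. This allows passage between `fineRel` and `avg (gpFine π)` by scalars on each colour.
-/
theorem exists_card_fine : ∃ n : Fin 6 → ℂ, ∀ x : G,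
    ((Finset.univ.filter fun z => gpFine π z = gpFine π x).card : ℂ) = n (gpColor π x) := by
  have key : ∀ x x' : G, gpColor π x = gpColor π x' →
      (Finset.univ.filter fun z => gpFine π z = gpFine π x).card =
      (Finset.univ.filter fun z => gpFine π z = gpFine π x').card := by
    intro x x' hx
    obtain ⟨c, rfl⟩ := _root_.isConj_iff.1 ((h.isConj_iff x x').2 hx)
    have hconj : ∀ z, gpColor π (c * z * c⁻¹) = gpColor π z := fun z =>
      ((h.isConj_iff _ _).1 (_root_.isConj_iff.2 ⟨c, rfl⟩)).symm
    refine Finset.card_equiv (MulAut.conj c).toEquiv fun z => ?_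
    simp [gpFine, hconj]
  refine ⟨fun c => ((Finset.univ.filter fun z =>
    gpFine π z = gpFine π (Function.surjInv h.gpColor_surjective c)).card : ℂ), fun x => ?_⟩
  rw [key x _ (Function.surjInv_eq h.gpColor_surjective _).symm]

theorem avg_fine_mem : avg (gpFine π) ∈ terwilliger G := by
  obtain ⟨n, hn⟩ := h.exists_card_fine
  have : avg (gpFine π) = ∑ c, (n c)⁻¹ • (fiberDiag (gpColor π) c * fineRel π) := by
    ext x y
    simp [Matrix.sum_apply, fiberDiag_mul_apply, avg, fineRel, hn]
  rw [this]
  exact sum_mem fun c _ => Subalgebra.smul_mem _ (mul_mem (h.fiberDiag_mem c) h.fineRel_mem) _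

theorem avg_mem : avg (gpColor π) ∈ terwilliger G := by
  obtain ⟨p, hp⟩ := exists_inflate_eq_avg h.gpColor_surjective
  exact hp ▸ h.inflate_mem p

theorem fiberIdem_mem (p : Fin 6 × Bool) : fiberIdem (gpColor π) (gpFine π) p ∈ terwilliger G := by
  refine mul_mem (h.fiberDiag_mem _) ?_
  cases p.2
  · exact sub_mem (one_mem _) h.avg_fine_mem
  · exact sub_mem h.avg_fine_mem h.avg_mem

theorem fiberIdem_refiningIndex_ne_zero (i : Fin 8) :
    fiberIdem (gpColor π) (gpFine π) (refiningIndex i) ≠ 0 := by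
  obtain ⟨u, v, hu, hv, huv, hπu, hπv⟩ := h.exists_ker
  rcases refiningIndex_cases i with ⟨c, hc, hi⟩ | ⟨c, hc, hi⟩
  · rw [hi]
    by_cases hc2 : 2 ≤ c
    · obtain ⟨q, hq, hqc⟩ := exists_quatColor_eq c hc2
      obtain ⟨x, rfl⟩ := h.surjective q
      -- Translation by a kernel element gives a second point in the same fine fibre. For colour `1`
      -- it could reach the identity, so two kernel elements are used there.
      have hπ : π (u * x) = π x := by rw [map_mul, hπu, one_mul]
      refine fiberIdem_false_ne_zero (x := x) (y := u * x) ((gpColor_of_map_ne hq).trans hqc)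
        (fun hh => hu (by simpa using hh)) (Prod.ext ?_ hπ.symm)
      change gpColor π x = gpColor π (u * x)
      rw [gpColor_of_map_ne hq, gpColor_of_map_ne (hπ ▸ hq), hπ]
    · obtain rfl : c = 1 := by clear hi; revert c; decide
      have hcu : gpColor π u = 1 := (gpColor_of_ne hu).trans ((quatColor_eq_one _).2 hπu)
      have hcv : gpColor π v = 1 := (gpColor_of_ne hv).trans ((quatColor_eq_one _).2 hπv)
      exact fiberIdem_false_ne_zero hcu huv (Prod.ext (hcu.trans hcv.symm) (hπu.trans hπv.symm))
  · rw [hi]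
    obtain ⟨q, r, hq, hr, hqr, hqc, hrc⟩ := exists_pair_quatColor_eq c hc
    obtain ⟨x, rfl⟩ := h.surjective q
    obtain ⟨y, rfl⟩ := h.surjective r
    exact fiberIdem_true_ne_zero ((gpColor_of_map_ne hq).trans hqc)
      ((gpColor_of_map_ne hr).trans hrc) fun hh => hqr (congrArg Prod.snd hh)

omit h in
theorem fiberIdem_eq_zero {p : Fin 6 × Bool} (hp : ∀ i, refiningIndex i ≠ p) :
    fiberIdem (gpColor π) (gpFine π) p = 0 := by
  rcases notMem_range_refiningIndex p hp with rfl | ⟨c, hc, rfl⟩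
  · refine fiberIdem_false_eq_zero fun x y hx hxy => ?_
    have hy : gpColor π y = 0 := (gpFine_eq hxy).symm.trans hx
    rw [gpColor_eq_zero.1 hx, gpColor_eq_zero.1 hy]
  · exact fiberIdem_true_eq_zero (fun _ _ => gpFine_eq) fun x y hx hy =>
      Prod.ext (hx.trans hy.symm) (map_eq_of_gpColor_le hc hx hy)

theorem isRefining :
    IsRefining (gpColor π) fun i => fiberIdem (gpColor π) (gpFine π) (refiningIndex i) where
  surjective := h.gpColor_surjective
  ortho :=
    { idem i := fiberIdem_mul_self (fun _ _ => gpFine_eq) _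
      ortho i j hij := fiberIdem_mul_of_ne (fun _ _ => gpFine_eq)
        fun hh => hij (refiningIndex_injective hh) }
  ne_zero := h.fiberIdem_refiningIndex_ne_zero
  avg_mul i := avg_mul_fiberIdem (fun _ _ => gpFine_eq) _
  mul_avg i := fiberIdem_mul_avg (fun _ _ => gpFine_eq) _
  avg_add_sum := by
    rw [← avg_add_sum_fiberIdem (κ := gpColor π) (ρ := gpFine π)]
    congr 1
    exact Fintype.sum_of_injective refiningIndex refiningIndex_injective _ _
      (fun p hp => fiberIdem_eq_zero fun i hi => hp ⟨i, hi⟩) fun i => rfl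

/-! ### Generators of `T(G)` inside the block algebra, and the primary component. -/

/-- The range of the block map of the class colouring, as a subalgebra. -/
noncomputable def blockAlgebra : Subalgebra ℂ (Matrix G G ℂ) :=
  Submodule.toSubalgebra (LinearMap.range (blockMap (gpColor π) fun i =>
    fiberIdem (gpColor π) (gpFine π) (refiningIndex i))) h.isRefining.one_mem_range
    fun _ _ => h.isRefining.mul_mem_range

theorem inflate_mem_blockAlgebra (f : Matrix (Fin 6) (Fin 6) ℂ) :
    inflate (gpColor π) f ∈ h.blockAlgebra := h.isRefining.inflate_mem_range f

theorem fiberIdem_mem_blockAlgebra (p : Fin 6 × Bool) :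
    fiberIdem (gpColor π) (gpFine π) p ∈ h.blockAlgebra := by
  by_cases hp : ∃ i, refiningIndex i = p
  · obtain ⟨i, rfl⟩ := hp
    exact h.isRefining.idem_mem_range i
  · rw [fiberIdem_eq_zero fun i hi => hp ⟨i, hi⟩]
    exact zero_mem _

theorem fiberDiag_mul_avg_mem_blockAlgebra (c : Fin 6) :
    fiberDiag (gpColor π) c * avg (gpColor π) ∈ h.blockAlgebra := by
  obtain ⟨p, hp⟩ := exists_inflate_eq_avg h.gpColor_surjective
  rw [← hp, fiberDiag_mul_inflate]
  exact h.inflate_mem_blockAlgebra _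

theorem fiberDiag_mul_avg_fine_mem_blockAlgebra (c : Fin 6) :
    fiberDiag (gpColor π) c * avg (gpFine π) ∈ h.blockAlgebra := by
  have : fiberDiag (gpColor π) c * avg (gpFine π) = fiberIdem (gpColor π) (gpFine π) (c, true) +
      fiberDiag (gpColor π) c * avg (gpColor π) := by
    rw [fiberIdem, ← mul_add, refinement, sub_add_cancel]
  rw [this]
  exact add_mem (h.fiberIdem_mem_blockAlgebra _) (h.fiberDiag_mul_avg_mem_blockAlgebra c)

theorem fiberDiag_mem_blockAlgebra (c : Fin 6) : fiberDiag (gpColor π) c ∈ h.blockAlgebra := by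
  have : fiberDiag (gpColor π) c = fiberIdem (gpColor π) (gpFine π) (c, false) +
      fiberDiag (gpColor π) c * avg (gpFine π) := by
    rw [fiberIdem, ← mul_add, refinement, sub_add_cancel, mul_one]
  rw [this]
  exact add_mem (h.fiberIdem_mem_blockAlgebra _) (h.fiberDiag_mul_avg_fine_mem_blockAlgebra c)

theorem fineRel_mem_blockAlgebra : fineRel π ∈ h.blockAlgebra := by
  obtain ⟨n, hn⟩ := h.exists_card_fine
  have : fineRel π = ∑ c, n c • (fiberDiag (gpColor π) c * avg (gpFine π)) := by
    ext x y
    have h0 := fiber_card_ne_zero (gpFine π) x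
    rw [hn] at h0
    simp [Matrix.sum_apply, fiberDiag_mul_apply, avg, fineRel, hn, h0]
  rw [this]
  exact sum_mem fun c _ =>
    Subalgebra.smul_mem _ (h.fiberDiag_mul_avg_fine_mem_blockAlgebra c) _

theorem colorAdj_mem_blockAlgebra (j : Fin 6) : colorAdj π j ∈ h.blockAlgebra := by
  -- On a block of equal colours the generic value of `gpColor π (y * x⁻¹)` is `2`. The `fineRel`
  -- term corrects it to `1` on equal cosets, and the identity term corrects that to `0` on the
  -- diagonal.
  have : colorAdj π j =
      inflate (gpColor π)
        (Matrix.of fun a b => if (if a = b then 2 else quatDiff a b) = j then 1 else 0) +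
      ((if 0 = j then 1 else 0) - (if 1 = j then 1 else 0) : ℂ) • (1 : Matrix G G ℂ) +
      ((if 1 = j then 1 else 0) - (if 2 = j then 1 else 0) : ℂ) • fineRel π := by
    ext x y
    simp only [colorAdj, Matrix.of_apply, gpColor_mul_inv, Matrix.add_apply, Matrix.smul_apply,
      inflate_apply, fineRel, gpFine, Prod.mk.injEq, Matrix.one_apply, smul_eq_mul]
    by_cases hc : gpColor π x = gpColor π y
    · by_cases hxy : x = y
      · simp only [hxy, if_true, and_self]
        ring
      · by_cases hq : π x = π y <;> simp [hc, hxy, hq]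
    · have hxy : x ≠ y := fun hxy => hc (by rw [hxy])
      simp [hc, hxy]
  rw [this]
  exact add_mem (add_mem (h.inflate_mem_blockAlgebra _) (Subalgebra.smul_mem _ (one_mem _) _))
    (Subalgebra.smul_mem _ h.fineRel_mem_blockAlgebra _)

theorem toSubmodule_terwilliger : Subalgebra.toSubmodule (terwilliger G) =
    LinearMap.range (blockMap (gpColor π) fun i =>
      fiberIdem (gpColor π) (gpFine π) (refiningIndex i)) := by
  apply le_antisymm
  · have hle : terwilliger G ≤ h.blockAlgebra := by
      refine Algebra.adjoin_le (Set.union_subset ?_ ?_)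
      · refine (Submodule.span_le (p := Subalgebra.toSubmodule h.blockAlgebra)).2 ?_
        rintro _ ⟨C, rfl⟩
        obtain ⟨g, rfl⟩ := ConjClasses.exists_rep C
        rw [h.adjMatrix_mk]
        exact h.colorAdj_mem_blockAlgebra _
      · refine (Submodule.span_le (p := Subalgebra.toSubmodule h.blockAlgebra)).2 ?_
        rintro _ ⟨C, rfl⟩
        obtain ⟨g, rfl⟩ := ConjClasses.exists_rep C
        rw [h.dualIdempotent_mk]
        exact h.fiberDiag_mem_blockAlgebra _
    exact fun M hM => hle hM
  · rintro _ ⟨⟨f, a⟩, rfl⟩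
    rw [blockMap_apply, Subalgebra.mem_toSubmodule]
    exact add_mem (h.inflate_mem f) (sum_mem fun i _ => Subalgebra.smul_mem _ (h.fiberIdem_mem _) _)

theorem isPrimaryComponent : IsPrimaryComponent
    (Ideal.span {h.isRefining.avgElem h.toSubmodule_terwilliger}) := by
  -- The all-ones matrix lies in the ideal and sends the basis vector at `1`, which is in the
  -- primary module because `A₀ = 1`, to the all-ones vector.
  refine ⟨h.isRefining.isMinimalTwoSided_avgIdeal _, _,
    h.isRefining.inflateElem_mem h.toSubmodule_terwilliger (Matrix.of fun _ _ => 1),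
    Pi.single 1 1, ⟨adjMatrix (ConjClasses.mk 1), Submodule.subset_span ⟨_, rfl⟩, ?_⟩, ?_⟩
  · have : adjMatrix (ConjClasses.mk (1 : G)) = 1 := by
      ext x y
      rw [h.adjMatrix_mk]
      simp [colorAdj, gpColor_one, gpColor_eq_zero, Matrix.one_apply, mul_inv_eq_one,
        eq_comm]
    rw [this]
    simp
  · intro h0
    have := congrFun h0 1
    rw [Matrix.mulVec_single_one] at this
    exact one_ne_zero this

end IsClassColoring

theorem isClassColoring_of_mulEquiv
    {φ : QuaternionGroup 2 →* MulAut (Multiplicative (ZMod 3 × ZMod 3))}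
    (hφ : Function.Injective φ)
    (e : G ≃* Multiplicative (ZMod 3 × ZMod 3) ⋊[φ] QuaternionGroup 2) :
    IsClassColoring (SemidirectProduct.rightHom.comp e.toMonoidHom) where
  surjective := SemidirectProduct.rightHom_surjective.comp e.surjective
  isConj_iff := isConj_iff_gpColor hφ e
  exists_ker := by
    have hinj : Function.Injective fun n => e.symm (SemidirectProduct.inl n) :=
      e.symm.injective.comp SemidirectProduct.inl_injective
    refine ⟨e.symm (SemidirectProduct.inl (.ofAdd (1, 0))),
      e.symm (SemidirectProduct.inl (.ofAdd (0, 1))), fun h1 => ?_, fun h1 => ?_, fun h1 => ?_,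
      by simp, by simp⟩
    · exact absurd (hinj (h1.trans (by simp : (1 : G) = e.symm (SemidirectProduct.inl 1))))
        (by decide)
    · exact absurd (hinj (h1.trans (by simp : (1 : G) = e.symm (SemidirectProduct.inl 1))))
        (by decide)
    · exact absurd (hinj h1) (by decide)

end Coloring

end GroupScheme

theorem theorem5 {G : Type*} [Group G] [Fintype G] [DecidableEq G]
    (φ : QuaternionGroup 2 →* MulAut (Multiplicative (ZMod 3 × ZMod 3)))
    (hφ : Function.Injective φ)
    (e : G ≃* Multiplicative (ZMod 3 × ZMod 3) ⋊[φ] QuaternionGroup 2) :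
    (∃ (V : Ideal (GroupScheme.terwilliger G)) (Z : Fin 8 → Ideal (GroupScheme.terwilliger G)),
      GroupScheme.IsPrimaryComponent V ∧
      Module.finrank ℂ V = Nat.card (ConjClasses G) ^ 2 ∧
      (∀ i, Module.finrank ℂ (Z i) = 1) ∧
      GroupScheme.IsWedderburnDecomposition
        (fun o : Option (Fin 8) => o.elim V Z)) ∧
    Module.finrank ℂ (GroupScheme.terwilliger G) = 44 := by
  have h := GroupScheme.isClassColoring_of_mulEquiv hφ e
  have hT := h.toSubmodule_terwilliger
  refine ⟨⟨_, _, h.isPrimaryComponent, ?_, fun i => ?_, h.isRefining.isWedderburnDecomposition hT⟩,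
    ?_⟩
  · rw [h.isRefining.finrank_avgIdeal, h.card_conjClasses, Fintype.card_fin]
  · exact GroupScheme.finrank_span_of_scalar (h.isRefining.idemElem_ne_zero hT i)
      (h.isRefining.exists_mul_idemElem hT i)
  · rw [h.isRefining.finrank_eq hT, Fintype.card_fin, Fintype.card_fin]
    norm_num
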